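/- **Conventions.** Let $M$ be a smooth 5-dimensional manifold. A *contact form* on $M$ is a smooth 1-form $\alpha$ with $\alpha\wedge(d\alpha)^2\neq 0$ everywhere; its *Reeb field* $R$ is determined by $\alpha(R)=1$, $\iota_R d\alpha=0$. Put $\xi=\ker\alpha$ and $\kappa=\tfrac12 d\alpha$. A *Sasakian structure* is a pair $(\alpha,J)$ where $\alpha$ is a contact form and $J$ is a smooth endomorphism of $TM$ with $J R=0$, $J(\xi)\subseteq\xi$, $J^2=-1$ on $\xi$, such that $g_J=\kappa(\cdot,J\cdot)$ is a $J$-Hermitian inner product on $\xi$ and $$N_J(X,Y):=[JX,JY]-J[X,JY]-J[JX,Y]+J^2[X,Y]=-d\alpha(X,Y)\,R$$ for all smooth vector fields $X,Y$. A *contact Calabi–Yau structure* on $M$ is a triple $(\alpha,J,\epsilon)$ where $(\alpha,J)$ is a Sasakian structure and $\epsilon$ is a nowhere vanishing smooth complex 2-form which is basic ($\iota_R\epsilon=0$, $\mathcal L_R\epsilon=0$), of type $(2,0)$ with respect to $J$ on $\xi$, and satisfies $\epsilon\wedge\overline\epsilon=c_2\,\kappa^2$, $d\epsilon=0$, where $c_n=(-1)^{n(n+1)/2}(2i)^n$,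 so $c_2=4$. A 5-dimensional *nilmanifold* is the compact quotient $M$ of a 5-dimensional connected nilpotent (real, Hausdorff) Lie group $G$ (that is, a connected Lie group whose Lie algebra is nilpotent) by a discrete subgroup $\Gamma$ acting by left translations. A contact Calabi–Yau structure $(\alpha,J,\epsilon)$ on $M$ is *invariant* if the pullbacks of $\alpha$, $J$, $\epsilon$ to $G$ under the projection $G\to M$ are left-invariant. **Theorem.** Let $M$ be a 5-dimensional nilmanifold, the quotient of $G$ by $\Gamma$ as above, which admits an invariant contact Calabi–Yau structure. Then the Lie algebra $\mathfrak g$ of $G$ is isomorphic to $(0,0,0,0,12+34)$; that is, there is a basis $\alpha_1,\dots,\alpha_5$ of $\mathfrak g^*$ such that $$d\alpha_1=d\alpha_2=d\alpha_3=d\alpha_4=0,\qquad d\alpha_5=\alpha_1\wedge\alpha_2+\alpha_3\wedge\alpha_4,$$ where $da(x,y)=-a([x,y])$ for $a\in\mathfrak g^*$ and $x,y\in\mathfrak g$. -/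

import Mathlib

open scoped Manifold ContDiff Topology

noncomputable section

/-! ### Differential forms and tensors on a manifold without boundary -/

namespace ContactCY

section Tensors

variable {E : Type*} [NormedAddCommGroup E] [NormedSpace ℝ E]
  {F : Type*} [NormedAddCommGroup F] [NormedSpace ℝ F]
  {M : Type*} [TopologicalSpace M] [ChartedSpace E M]
  {N : Type*} [TopologicalSpace N] [ChartedSpace E N]

variable (E F M) in
/-- A (not necessarily smooth) `F`-valued differential `k`-form on the manifold `M` modelled
on `E`. -/
abbrev DForm (k : ℕ) : Type _ :=
  Π x : M, (TangentSpace 𝓘(ℝ, E) x) [⋀^Fin k]→L[ℝ] F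

variable (E M) in
/-- A (not necessarily smooth) vector field on `M`. -/
abbrev VField : Type _ := Π x : M, TangentSpace 𝓘(ℝ, E) x

variable (E M) in
/-- A (not necessarily smooth) field of endomorphisms of the tangent spaces of `M`. -/
abbrev EndField : Type _ :=
  Π x : M, TangentSpace 𝓘(ℝ, E) x →L[ℝ] TangentSpace 𝓘(ℝ, E) x

/-- Pullback of a differential form under a map `f : N → M`. -/
def DForm.pullback {k : ℕ} (f : N → M) (γ : DForm E F M k) : DForm E F N k :=
  fun x => (γ (f x)).compContinuousLinearMap (mfderiv 𝓘(ℝ, E) 𝓘(ℝ, E) f x)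

/-- Pullback of a field of endomorphisms under a map `f : N → M` with invertible differential. -/
def EndField.pullback (f : N → M) (J : EndField E M) : EndField E N :=
  fun x => (mfderiv 𝓘(ℝ, E) 𝓘(ℝ, E) f x).inverse ∘L J (f x) ∘L
    mfderiv 𝓘(ℝ, E) 𝓘(ℝ, E) f x

/-- The coordinate expression of a form in the preferred chart at `x₀`. -/
def DForm.inChart {k : ℕ} (γ : DForm E F M k) (x₀ : M) : E → E [⋀^Fin k]→L[ℝ] F :=
  fun y => (γ ((extChartAt 𝓘(ℝ, E) x₀).symm y)).compContinuousLinearMap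
    (mfderiv 𝓘(ℝ, E) 𝓘(ℝ, E) (extChartAt 𝓘(ℝ, E) x₀).symm y)

/-- A form is smooth if all its coordinate expressions are. -/
def DForm.Smooth {k : ℕ} (γ : DForm E F M k) : Prop :=
  ∀ x₀ : M, ContDiffOn ℝ ∞ (γ.inChart x₀) (extChartAt 𝓘(ℝ, E) x₀).target

/-- The exterior derivative of a form, computed at `x₀` in the preferred chart at `x₀`. The
normalization is `dα(X, Y) = X(α(Y)) - Y(α(X)) - α([X, Y])` on 1-forms. -/
def DForm.d {k : ℕ} (γ : DForm E F M k) : DForm E F M (k + 1) :=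
  fun x₀ => (extDeriv (γ.inChart x₀) (extChartAt 𝓘(ℝ, E) x₀ x₀)).compContinuousLinearMap
    (mfderiv 𝓘(ℝ, E) 𝓘(ℝ, E) (extChartAt 𝓘(ℝ, E) x₀) x₀)

/-- The contraction `ι_R γ` of a form with a vector field. -/
def DForm.contract {k : ℕ} (R : VField E M) (γ : DForm E F M (k + 1)) : DForm E F M k :=
  fun x => ContinuousAlternatingMap.curryLeft (𝕜 := ℝ) (E := E) (F := F) (γ x) (R x)

/-- The Lie derivative `ℒ_R γ` of a form along a vector field, `ℒ_R = ι_R d + d ι_R`. -/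
def DForm.lieDeriv {k : ℕ} (R : VField E M) (γ : DForm E F M (k + 1)) : DForm E F M (k + 1) :=
  fun x => DForm.contract R γ.d x + (DForm.contract R γ).d x

/-- The wedge product of alternating forms with values in an algebra, with the normalization
`(a ∧ b)(v, w) = a(v) b(w) - a(w) b(v)` on 1-forms. -/
def wedge {V A : Type*} [AddCommGroup V] [Module ℝ V] [CommRing A] [Algebra ℝ A] {p q : ℕ}
    (a : V [⋀^Fin p]→ₗ[ℝ] A) (b : V [⋀^Fin q]→ₗ[ℝ] A) : V [⋀^Fin (p + q)]→ₗ[ℝ] A :=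
  ((LinearMap.mul' ℝ A).compAlternatingMap (a.domCoprod b)).domDomCongr finSumFinEquiv

end Tensors

/-! ### Contact Calabi–Yau structures in dimension 5 -/

section Structures

variable {E : Type*} [NormedAddCommGroup E] [NormedSpace ℝ E]
  {M : Type*} [TopologicalSpace M] [ChartedSpace E M]

/-- `α` is a contact form on a 5-dimensional manifold: `α ∧ (dα)²` vanishes nowhere. -/
def IsContactForm (α : DForm E ℝ M 1) : Prop :=
  α.Smooth ∧ ∀ x, wedge (α x).toAlternatingMap
    (wedge (α.d x).toAlternatingMap (α.d x).toAlternatingMap) ≠ 0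

/-- `R` is the Reeb vector field of `α`: `α(R) = 1` and `ι_R dα = 0`. (For a contact form such an
`R` exists, is unique and is smooth.) -/
def IsReeb (α : DForm E ℝ M 1) (R : VField E M) : Prop :=
  ∀ x, α x ![R x] = 1 ∧ ∀ v : TangentSpace 𝓘(ℝ, E) x, α.d x ![R x, v] = 0

/-- The form `κ = ½ dα`. -/
def kappa (α : DForm E ℝ M 1) : DForm E ℝ M 2 := fun x => (1 / 2 : ℝ) • α.d x

/-- `J` is a `κ`-calibrated complex structure on `ξ = ker α`, extended to the tangent bundle
by `J R = 0`: it preserves `ξ`, `J² = -1` on `ξ`, and `g_J(v, w) = κ(v, J w)` is a `J`-Hermitian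
inner product on `ξ`. -/
structure IsCalibrated (α : DForm E ℝ M 1) (R : VField E M) (J : EndField E M) : Prop where
  apply_reeb : ∀ x, J x (R x) = 0
  mem_ker : ∀ x v, α x ![v] = 0 → α x ![J x v] = 0
  sq : ∀ x v, α x ![v] = 0 → J x (J x v) = -v
  symm : ∀ x v w, α x ![v] = 0 → α x ![w] = 0 →
    kappa α x ![v, J x w] = kappa α x ![w, J x v]
  pos : ∀ x v, α x ![v] = 0 → v ≠ 0 → 0 < kappa α x ![v, J x v]
  hermitian : ∀ x v w, α x ![v] = 0 → α x ![w] = 0 →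
    kappa α x ![J x v, J x (J x w)] = kappa α x ![v, J x w]

/-- The Nijenhuis tensor evaluated on two vector fields,
`N_J(X, Y) = [JX, JY] - J[X, JY] - J[JX, Y] + J²[X, Y]`. -/
def nijenhuis (J : EndField E M) (X Y : VField E M) : VField E M := fun x =>
  VectorField.mlieBracket 𝓘(ℝ, E) (fun y => J y (X y)) (fun y => J y (Y y)) x
    - J x (VectorField.mlieBracket 𝓘(ℝ, E) X (fun y => J y (Y y)) x)
    - J x (VectorField.mlieBracket 𝓘(ℝ, E) (fun y => J y (X y)) Y x)
    + J x (J x (VectorField.mlieBracket 𝓘(ℝ, E) X Y x))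

variable [IsManifold 𝓘(ℝ, E) 1 M]

/-- Smooth vector fields. -/
def VField.Smooth (X : VField E M) : Prop :=
  ContMDiff 𝓘(ℝ, E) 𝓘(ℝ, E).tangent ∞ (fun x => (X x : TangentBundle 𝓘(ℝ, E) M))

/-- Smooth fields of endomorphisms. -/
def EndField.Smooth (J : EndField E M) : Prop :=
  ContMDiff 𝓘(ℝ, E) (𝓘(ℝ, E).prod 𝓘(ℝ, E →L[ℝ] E)) ∞
    (fun x => Bundle.TotalSpace.mk' (E →L[ℝ] E)
      (E := fun x : M => TangentSpace 𝓘(ℝ, E) x →L[ℝ] TangentSpace 𝓘(ℝ, E) x) x (J x))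

/-- `(α, J)` is a Sasakian structure with Reeb field `R`: `α` is a contact form, `J` is smooth and
`κ`-calibrated, and `N_J = -dα ⊗ R`. -/
structure IsSasakian (α : DForm E ℝ M 1) (R : VField E M) (J : EndField E M) : Prop where
  contact : IsContactForm α
  reeb : IsReeb α R
  smooth : J.Smooth
  calibrated : IsCalibrated α R J
  nijenhuis_eq : ∀ X Y : VField E M, X.Smooth → Y.Smooth → ∀ x,
    nijenhuis J X Y x = -(α.d x ![X x, Y x]) • R x

/-- The constant `c_n = (-1)^(n(n+1)/2) (2i)^n`. -/
def cyConst (n : ℕ) : ℂ := (-1) ^ (n * (n + 1) / 2) * (2 * Complex.I) ^ n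

variable (E M) in
/-- A contact Calabi–Yau structure `(α, J, ε)` on a 5-dimensional manifold; the Reeb field of
`α`, which `α` determines, is recorded as well. -/
structure ContactCalabiYau5 where
  /-- the contact form -/
  α : DForm E ℝ M 1
  /-- the Reeb vector field of `α` -/
  R : VField E M
  /-- the complex structure on `ker α`, extended by `J R = 0` -/
  J : EndField E M
  /-- the complex volume form -/
  ε : DForm E ℂ M 2
  sasakian : IsSasakian α R J
  smooth : ε.Smooth
  /-- `ε` is basic -/
  contract_reeb : ∀ x, DForm.contract R ε x = 0
  lieDeriv_reeb : ∀ x, DForm.lieDeriv R ε x = 0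
  /-- `ε` is of type `(2, 0)` with respect to `J` on `ker α` -/
  type_two_zero : ∀ x (v w : TangentSpace 𝓘(ℝ, E) x), α x ![v] = 0 → α x ![w] = 0 →
    ε x ![J x v, w] = Complex.I * ε x ![v, w]
  ne_zero : ∀ x, ε x ≠ 0
  /-- `ε ∧ ε̄ = c₂ κ²` -/
  wedge_conj : ∀ x,
    wedge (ε x).toAlternatingMap
      (Complex.conjCLE.toContinuousLinearMap.compContinuousAlternatingMap (ε x)).toAlternatingMap =
    cyConst 2 • wedge
      (Complex.ofRealCLM.compContinuousAlternatingMap (kappa α x)).toAlternatingMap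
      (Complex.ofRealCLM.compContinuousAlternatingMap (kappa α x)).toAlternatingMap
  closed : ∀ x, ε.d x = 0

end Structures

/-! ### Nilmanifolds -/

section LieGroups

variable {G : Type*} [Group G] [TopologicalSpace G]

instance lieGroup_minSmoothness {E : Type*} [NormedAddCommGroup E] [NormedSpace ℝ E]
    [ChartedSpace E G] [LieGroup 𝓘(ℝ, E) ∞ G] : LieGroup 𝓘(ℝ, E) (minSmoothness ℝ 3) G :=
  LieGroup.of_le (n := ∞) (by simp only [minSmoothness_of_isRCLikeNormedField]; exact ENat.LEInfty.out)

/-- A discrete subgroup of a Hausdorff topological group acts properly discontinuously by left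
translations. -/
instance properlyDiscontinuousSMul_of_discrete [IsTopologicalGroup G] [T2Space G]
    (Γ : Subgroup G) [DiscreteTopology Γ] : ProperlyDiscontinuousSMul Γ G :=
  Γ.properlyDiscontinuousSMul_of_tendsto_cofinite
    (Γ.tendsto_coe_cofinite_of_discrete (SetLike.isDiscrete_iff_discreteTopology.mpr ‹_›))

/-- The space of orbits of `Γ` acting on `G` by left translations: this is the side on which
left-invariant tensors of `G` descend to the quotient. -/
abbrev LeftQuotient (Γ : Subgroup G) : Type _ := MulAction.orbitRel.Quotient Γ G

/-- The projection of `G` onto the quotient by `Γ`. -/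
def proj (Γ : Subgroup G) : G → LeftQuotient Γ := Quotient.mk _

/-- A local inverse of the projection composed with the projection is locally the translation
by an element of `Γ`. -/
theorem localInverse_proj_eventuallyEq [IsTopologicalGroup G] {Γ : Subgroup G}
    (hf : IsLocalHomeomorph (proj Γ)) {a g : G} (hg : proj Γ g ∈ (hf.localInverseAt a).source) :
    ∃ c : Γ, ∀ᶠ x in 𝓝 g, hf.localInverseAt a (proj Γ x) = (c : G) * x := by
  set L := hf.localInverseAt a with hL
  have hproj : ∀ y ∈ L.source, proj Γ (L y) = y := fun y hy =>
    hf.apply_localInverseAt_of_mem hy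
  obtain ⟨c, hc⟩ : ∃ c : Γ, (c : G) * g = L (proj Γ g) := by
    have := Quotient.exact (hproj _ hg)
    obtain ⟨c, hc⟩ := this
    exact ⟨c, hc⟩
  refine ⟨c, ?_⟩
  have hinj : L.target.InjOn (proj Γ) := hf.injOn_localInverseAt_target
  have h1 : ∀ᶠ x in 𝓝 g, proj Γ x ∈ L.source :=
    hf.continuous.continuousAt.eventually (L.open_source.mem_nhds hg)
  have h2 : ∀ᶠ x in 𝓝 g, (c : G) * x ∈ L.target := by
    refine (continuous_const_mul (c : G)).continuousAt.eventually
      (L.open_target.mem_nhds ?_)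
    simpa only [hc] using L.map_source hg
  filter_upwards [h1, h2] with x hx1 hx2
  refine hinj (L.map_source hx1) hx2 ?_
  rw [hproj _ hx1]
  exact (Quotient.sound (⟨c, rfl⟩ : (MulAction.orbitRel Γ G) ((c : G) * x) x)).symm

variable {E : Type*} [NormedAddCommGroup E] [NormedSpace ℝ E] [ChartedSpace E G]

/-- A differential form on the Lie group `G` is left-invariant. -/
def DForm.IsLeftInvariant {F : Type*} [NormedAddCommGroup F] [NormedSpace ℝ F] {k : ℕ}
    (γ : DForm E F G k) : Prop :=
  ∀ a : G, γ.pullback (fun x => a * x) = γ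

/-- A field of endomorphisms on the Lie group `G` is left-invariant. -/
def EndField.IsLeftInvariant (J : EndField E G) : Prop :=
  ∀ a : G, J.pullback (fun x => a * x) = J

variable [IsTopologicalGroup G] [T2Space G] [LocallyCompactSpace G]

/-- The quotient by a discrete subgroup, with the charts obtained from local inverses of the
projection, is a smooth manifold. -/
instance isManifold_leftQuotient [LieGroup 𝓘(ℝ, E) ∞ G] (Γ : Subgroup G) [DiscreteTopology Γ] :
    IsManifold 𝓘(ℝ, E) ∞ (LeftQuotient Γ) := by
  have hf : IsLocalHomeomorph (proj Γ) :=
    (isQuotientCoveringMap_quotientMk_of_properlyDiscontinuousSMul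
      (G := Γ) (E := G)).isCoveringMap.isLocalHomeomorph
  refine isManifold_of_contDiffOn _ _ _ ?_
  rintro e e' ⟨q, rfl⟩ ⟨q', rfl⟩
  generalize (Quotient.mk_surjective (s := MulAction.orbitRel Γ G)).hasRightInverse.choose q = a
  generalize (Quotient.mk_surjective (s := MulAction.orbitRel Γ G)).hasRightInverse.choose q' = a'
  rintro y ⟨hy, -⟩
  refine ContDiffAt.contDiffWithinAt ?_
  simp only [modelWithCornersSelf_coe, modelWithCornersSelf_coe_symm, Function.id_comp,
    Function.comp_id, Set.preimage_id] at hy ⊢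
  have hy1 : y ∈ (chartAt E a).target := hy.1.1
  have hs : ∀ z, (hf.localInverseAt a).symm ((chartAt E a).symm z)
      = proj Γ ((chartAt E a).symm z) := fun z => congrFun (hf.localInverseAt_symm (x := a)) _
  have hy2 : proj Γ ((chartAt E a).symm y) ∈ (hf.localInverseAt a').source := by
    rw [← hs]; exact hy.2.1
  have hy3 : hf.localInverseAt a' (proj Γ ((chartAt E a).symm y)) ∈ (chartAt E a').source := by
    rw [← hs]; exact hy.2.2
  obtain ⟨c, hc⟩ := localInverse_proj_eventuallyEq hf hy2
  have hcont : ContMDiffAt 𝓘(ℝ, E) 𝓘(ℝ, E) ∞ (chartAt E a).symm y :=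
    (contMDiffOn_chart_symm (I := 𝓘(ℝ, E)) (n := ∞) (x := a)).contMDiffAt
      ((chartAt E a).open_target.mem_nhds hy1)
  rw [hc.self_of_nhds] at hy3
  have hmain : ContMDiffAt 𝓘(ℝ, E) 𝓘(ℝ, E) ∞
      (fun z => chartAt E a' ((c : G) * (chartAt E a).symm z)) y := by
    refine ContMDiffAt.comp y (g := chartAt E a')
      ((contMDiffOn_chart (I := 𝓘(ℝ, E)) (n := ∞) (x := a')).contMDiffAt
        ((chartAt E a').open_source.mem_nhds hy3)) ?_
    exact (contMDiff_mul_left (I := 𝓘(ℝ, E)) (n := ∞) (a := (c : G))).contMDiffAt.comp y hcont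
  refine (contMDiffAt_iff_contDiffAt.mp hmain).congr_of_eventuallyEq ?_
  filter_upwards [hcont.continuousAt.eventually hc] with z hz
  rw [← hs] at hz
  exact congrArg (chartAt E a') hz

/-- A contact Calabi–Yau structure `(α, J, ε)` on the quotient of `G` by `Γ` is invariant if it is
induced by left-invariant tensors on `G`. -/
def ContactCalabiYau5.IsInvariant [LieGroup 𝓘(ℝ, E) ∞ G] {Γ : Subgroup G} [DiscreteTopology Γ]
    (S : ContactCalabiYau5 E (LeftQuotient Γ)) : Prop :=
  DForm.IsLeftInvariant (DForm.pullback (proj Γ) S.α) ∧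
  EndField.IsLeftInvariant (EndField.pullback (proj Γ) S.J) ∧
  DForm.IsLeftInvariant (DForm.pullback (proj Γ) S.ε)

end LieGroups

/-! ### The Lie algebra `(0,0,0,0,12+34)` -/

section LieAlgebras

variable {L : Type*} [LieRing L] [LieAlgebra ℝ L]

/-- The differential `da(x, y) = -a([x, y])` of a covector on a Lie algebra. -/
def covectorD (a : Module.Dual ℝ L) (x y : L) : ℝ := -a ⁅x, y⁆

/-- The wedge product of two covectors. -/
def covectorWedge (a b : Module.Dual ℝ L) (x y : L) : ℝ := a x * b y - a y * b x

variable (L) in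
/-- The Lie algebra `L` is isomorphic to `(0,0,0,0,12+34)`: the dual of `L` has a basis
`a₁, …, a₅` with `da₁ = da₂ = da₃ = da₄ = 0` and `da₅ = a₁ ∧ a₂ + a₃ ∧ a₄`. -/
def IsType00001234 : Prop :=
  ∃ a : Module.Basis (Fin 5) ℝ (Module.Dual ℝ L),
    (∀ x y, covectorD (a 0) x y = 0) ∧ (∀ x y, covectorD (a 1) x y = 0) ∧
    (∀ x y, covectorD (a 2) x y = 0) ∧ (∀ x y, covectorD (a 3) x y = 0) ∧
    ∀ x y, covectorD (a 4) x y = covectorWedge (a 0) (a 1) x y + covectorWedge (a 2) (a 3) x y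

end LieAlgebras

end ContactCY
end

/-!
An invariant contact Calabi–Yau structure is determined by its values at one point, which are
tensors `α, R, J, ε` on the Lie algebra `𝔤` (`LieContactCY`). An invariant form is constant on
left-invariant fields, so in the formula expressing `dγ` through vector fields only the bracket
terms remain (`d_apply_liftTangent`): `dα(v, w) = -α([v, w])`, and `dε = 0` becomes
`ε([x, y], z) + ε([y, z], x) + ε([z, x], y) = 0`. Since the charts of the quotient are charts of `G`
read through the projection, this computation takes place in a chart of `G`.

The rest is linear algebra. As `dα` is nondegenerate on `ξ = ker α`, the center of `𝔤` lies on the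
Reeb line, and by nilpotency it is not zero: `R` is central. If `𝔤` is not abelian modulo `R`, take
`z ≠ 0` in `ξ` that is central modulo `R`. Closedness of `ε` gives `ε([x, y], z) = 0`, so that
`[x, y]` lies in the span of `R, z, J z`, because `ε` is a complex volume form on the complex plane
`ξ`; closedness of `dα` removes the component along `J z` (`LieContactCY.exists_lie_eq`). Closedness
of `ε` on `x, J x, J z` then shows that `J z` is central modulo `R` as well
(`LieContactCY.exists_lie_J_eq`). Applied to both `z` and `J z`, the first step leaves only
`[x, y] ∈ ℝ R` (`LieContactCY.lie_eq`). So `[x, y] = -dα(x, y) R`, and a symplectic basis of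
`(ξ, dα)` together with `R` is dual to the required basis of `𝔤*`. The integrability of `J` is not
needed.
-/

open scoped Manifold ContDiff Topology

noncomputable section
namespace ContactCY

/-! ### Contact Calabi–Yau structures on a nilpotent Lie algebra -/

section Algebra

variable {L : Type*} [LieRing L] [LieAlgebra ℝ L]

variable (L) in
/-- The values at one point of an invariant contact Calabi–Yau structure, as tensors on the Lie
algebra `L`. The differentials are the algebraic ones, `dα(v, w) = -α ⁅v, w⁆` and
`dε(x, y, z) = -ε(⁅x, y⁆, z) - …`. Only the conditions that determine the Lie algebra are kept: the
integrability of `J` and the normalization of `ε ∧ ε̄` do not appear. -/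
structure LieContactCY where
  /-- the contact covector -/
  α : Module.Dual ℝ L
  /-- the Reeb vector -/
  R : L
  /-- the complex structure on `ker α` -/
  J : L →ₗ[ℝ] L
  /-- the complex volume form -/
  ε : L →ₗ[ℝ] L →ₗ[ℝ] ℂ
  α_R : α R = 1
  /-- `ι_R dα = 0` -/
  α_lie_R : ∀ v, α ⁅R, v⁆ = 0
  α_J : ∀ v, α v = 0 → α (J v) = 0
  J_J : ∀ v, α v = 0 → J (J v) = -v
  /-- `dα(·, J ·)` is symmetric on `ker α` -/
  lie_J_symm : ∀ v w, α v = 0 → α w = 0 → α ⁅v, J w⁆ = α ⁅w, J v⁆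
  /-- `dα(·, J ·)` is positive definite on `ker α` -/
  lie_J_neg : ∀ v, α v = 0 → v ≠ 0 → α ⁅v, J v⁆ < 0
  ε_self : ∀ v, ε v v = 0
  /-- `ι_R ε = 0` -/
  ε_R : ∀ v, ε R v = 0
  /-- `ε` is of type `(2, 0)` -/
  ε_J : ∀ v w, α v = 0 → α w = 0 → ε (J v) w = Complex.I * ε v w
  ε_ne : ε ≠ 0
  /-- `dε = 0` -/
  ε_closed : ∀ x y z, ε ⁅x, y⁆ z + ε ⁅y, z⁆ x + ε ⁅z, x⁆ y = 0

/-- A nilpotent Lie algebra modulo a proper ideal `N` has nonzero center. -/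
theorem exists_notMem_lie_mem [LieRing.IsNilpotent L] {N : LieSubmodule ℝ L L} (hN : N ≠ ⊤) :
    ∃ x, x ∉ N ∧ ∀ y : L, ⁅y, x⁆ ∈ N := by
  by_contra! h
  obtain ⟨k, hk⟩ := (LieModule.isNilpotent_iff_exists_ucs_eq_top (R := ℝ) (L := L) (M := L)).1 ‹_›
  refine hN (top_le_iff.1 (hk ▸ LieSubmodule.ucs_le_of_normalizer_eq_self ?_ k))
  refine le_antisymm (fun x hx => ?_) N.le_normalizer
  by_contra hxN
  obtain ⟨y, hy⟩ := h x hxN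
  exact hy ((LieSubmodule.mem_normalizer N x).1 hx y)

namespace LieContactCY

variable (S : LieContactCY L)

/-- The component of a central element in `ker α` is killed by `dα`, which is nondegenerate there:
the center lies on the Reeb line. -/
theorem eq_smul_R {z : L} (hz : ∀ y : L, ⁅z, y⁆ = 0) : z = S.α z • S.R := by
  by_contra h
  have h0 : S.α (z - S.α z • S.R) = 0 := by simp [S.α_R]
  have := S.lie_J_neg _ h0 (sub_ne_zero.2 h)
  rw [sub_lie, hz, smul_lie, map_sub, map_smul, S.α_lie_R] at this
  simp at this

theorem R_ne : S.R ≠ 0 := fun h => by simpa [h] using S.α_R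

/-- The center is nonzero and lies on the Reeb line, so the Reeb vector is central. -/
theorem R_lie [LieRing.IsNilpotent L] (y : L) : ⁅S.R, y⁆ = 0 := by
  have : (⊥ : LieSubmodule ℝ L L) ≠ ⊤ := by
    intro h
    have : S.R ∈ (⊥ : LieSubmodule ℝ L L) := h ▸ LieSubmodule.mem_top _
    exact S.R_ne (by simpa using this)
  obtain ⟨x, hx, hxy⟩ := exists_notMem_lie_mem this
  have hc : ∀ y : L, ⁅x, y⁆ = 0 := fun y => by
    rw [← lie_skew, (LieSubmodule.mem_bot _).1 (hxy y), neg_zero]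
  have hxR := S.eq_smul_R hc
  have h0 : S.α x ≠ 0 := fun h => hx (by rw [hxR, h]; simp)
  have h1 := hc y
  rw [hxR, smul_lie] at h1
  exact (smul_eq_zero.1 h1).resolve_left h0

theorem ε_swap (v w : L) : S.ε v w = -S.ε w v := by
  have := S.ε_self (v + w)
  simp only [map_add, LinearMap.add_apply, S.ε_self] at this
  linear_combination this

theorem ε_R_right (v : L) : S.ε v S.R = 0 := by rw [S.ε_swap, S.ε_R, neg_zero]

theorem ε_J_right (v w : L) (hv : S.α v = 0) (hw : S.α w = 0) :
    S.ε v (S.J w) = Complex.I * S.ε v w := by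
  rw [S.ε_swap, S.ε_J w v hw hv, S.ε_swap v w]; ring

/-- The projection onto `ker α` along the Reeb vector. -/
def toKer (v : L) : L := v - S.α v • S.R

theorem α_toKer (v : L) : S.α (S.toKer v) = 0 := by simp [toKer, S.α_R]

theorem ε_toKer_left (v w : L) : S.ε (S.toKer v) w = S.ε v w := by simp [toKer, S.ε_R]

theorem ε_toKer_right (v w : L) : S.ε v (S.toKer w) = S.ε v w := by simp [toKer, S.ε_R_right]

theorem linearIndependent_R_self_J {u : L} (hu : S.α u = 0) (hu0 : u ≠ 0) :
    LinearIndependent ℝ ![S.R, u, S.J u] := by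
  rw [Fintype.linearIndependent_iff]
  intro g hg
  simp only [Fin.sum_univ_three, Matrix.cons_val_zero, Matrix.cons_val_one, Matrix.cons_val] at hg
  have ha : g 0 = 0 := by simpa [S.α_R, hu, S.α_J u hu] using congrArg S.α hg
  rw [ha, zero_smul, zero_add] at hg
  have hJ : g 1 • S.J u - g 2 • u = 0 := by
    simpa [S.J_J u hu, sub_eq_add_neg] using congrArg S.J hg
  have hs : (g 1 ^ 2 + g 2 ^ 2) • u = 0 := by
    have : (g 1 ^ 2 + g 2 ^ 2) • u =
        g 1 • (g 1 • u + g 2 • S.J u) - g 2 • (g 1 • S.J u - g 2 • u) := by module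
    rw [this, hg, hJ]; simp
  have := (smul_eq_zero.1 hs).resolve_right hu0
  have h1 : g 1 = 0 := by nlinarith [sq_nonneg (g 1), sq_nonneg (g 2)]
  have h2 : g 2 = 0 := by nlinarith [sq_nonneg (g 1), sq_nonneg (g 2)]
  intro i; fin_cases i <;> assumption

/-- `ε(·, u)` is complex linear on `ker α`, hence onto `ℂ` as soon as it is nonzero; its kernel
then has real dimension 3, so is spanned by `R`, `u` and `J u`. -/
theorem exists_of_ε_eq_zero_of_ne (hdim : Module.finrank ℝ L = 5) {u x v : L}
    (hu : S.α u = 0) (hx : S.ε x u ≠ 0) (hv : S.ε v u = 0) :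
    ∃ a b c : ℝ, v = a • S.R + b • u + c • S.J u := by
  have : FiniteDimensional ℝ L := .of_finrank_pos (by omega)
  set f : L →ₗ[ℝ] ℂ := S.ε.flip u with hf
  have hsurj : Function.Surjective f := by
    intro c
    have hx' : S.ε (S.toKer x) u ≠ 0 := by rwa [S.ε_toKer_left]
    -- `t • toKer x`, for the complex structure `J`, is a preimage of `c`
    set t := c / S.ε (S.toKer x) u with ht
    refine ⟨t.re • S.toKer x + t.im • S.J (S.toKer x), ?_⟩
    have : f (t.re • S.toKer x + t.im • S.J (S.toKer x)) = t * S.ε (S.toKer x) u := by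
      simp only [hf, map_add, map_smul, LinearMap.flip_apply, S.ε_J _ _ (S.α_toKer x) hu,
        Complex.real_smul]
      conv_rhs => rw [← Complex.re_add_im t]
      ring
    rw [this, ht, div_mul_cancel₀ _ hx']
  have hker : Module.finrank ℝ (LinearMap.ker f) = 3 := by
    have := f.finrank_range_add_finrank_ker
    rw [LinearMap.range_eq_top.2 hsurj, finrank_top, Complex.finrank_real_complex, hdim] at this
    omega
  have hu0 : u ≠ 0 := by rintro rfl; simp at hx
  have hli := S.linearIndependent_R_self_J hu hu0
  have hle : Submodule.span ℝ (Set.range ![S.R, u, S.J u]) ≤ LinearMap.ker f := by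
    rw [Submodule.span_le]
    rintro _ ⟨i, rfl⟩
    fin_cases i <;> simp [hf, S.ε_R, S.ε_self, S.ε_J u u hu hu]
  have heq := Submodule.eq_of_le_of_finrank_eq hle
    (by rw [hker, finrank_span_eq_card hli, Fintype.card_fin])
  have hv' : v ∈ LinearMap.ker f := hv
  rw [← heq, Submodule.mem_span_range_iff_exists_fun] at hv'
  obtain ⟨c, hc⟩ := hv'
  exact ⟨c 0, c 1, c 2, by rw [← hc, Fin.sum_univ_three]; rfl⟩

/-- `ε` is nondegenerate on `ker α`: a vector of the radical would be a complex multiple of any `u`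
with `ε(u, w) ≠ 0`, and `ε(·, w)` would vanish on it. -/
theorem exists_ε_ne_zero (hdim : Module.finrank ℝ L = 5) {z : L} (hz : S.α z = 0) (hz0 : z ≠ 0) :
    ∃ x, S.ε x z ≠ 0 := by
  by_contra! h
  obtain ⟨u, w, huw⟩ : ∃ u w, S.ε u w ≠ 0 := by
    by_contra! h0
    exact S.ε_ne (by ext u w; exact h0 u w)
  rw [← S.ε_toKer_left] at huw
  set u' := S.toKer u
  have hu' : S.α u' = 0 := S.α_toKer u
  obtain ⟨a, b, c, hzu⟩ := S.exists_of_ε_eq_zero_of_ne hdim hu' (x := w) (v := z)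
    (by rwa [S.ε_swap, neg_ne_zero]) (by rw [S.ε_swap, h, neg_zero])
  have ha : a = 0 := by
    have := congrArg S.α hzu
    simpa [S.α_R, hu', S.α_J _ hu', hz] using this.symm
  have h1 : ((b : ℂ) + c * Complex.I) * S.ε u' w = 0 := by
    have h2 : S.ε z (S.toKer w) = 0 := by rw [S.ε_swap, h, neg_zero]
    rw [hzu, ha] at h2
    simp only [zero_smul, zero_add, map_add, map_smul, LinearMap.add_apply, LinearMap.smul_apply,
      S.ε_J _ _ hu' (S.α_toKer w), S.ε_toKer_right, Complex.real_smul] at h2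
    linear_combination h2
  have h3 := (mul_eq_zero.1 h1).resolve_right huw
  have hb : b = 0 := by simpa using congrArg Complex.re h3
  have hc : c = 0 := by simpa using congrArg Complex.im h3
  exact hz0 (by rw [hzu, ha, hb, hc]; simp)

theorem exists_of_ε_eq_zero (hdim : Module.finrank ℝ L = 5) {u v : L}
    (hu : S.α u = 0) (hu0 : u ≠ 0) (hv : S.ε v u = 0) :
    ∃ a b c : ℝ, v = a • S.R + b • u + c • S.J u := by
  obtain ⟨x, hx⟩ := S.exists_ε_ne_zero hdim hu hu0
  exact S.exists_of_ε_eq_zero_of_ne hdim hu hx hv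

/-- If `z ∈ ker α` is central modulo the Reeb vector, the closedness of `ε` and of `dα` confine
all brackets to the span of `R` and `z`. -/
theorem exists_lie_eq [LieRing.IsNilpotent L] (hdim : Module.finrank ℝ L = 5) {z : L}
    (hz : S.α z = 0) (hz0 : z ≠ 0) (hzc : ∀ x, ∃ t : ℝ, ⁅z, x⁆ = t • S.R) (x y : L) :
    ∃ a b : ℝ, ⁅x, y⁆ = a • S.R + b • z := by
  obtain ⟨s, hs⟩ := hzc x
  obtain ⟨t, ht⟩ := hzc y
  have h1 := S.ε_closed x y z
  rw [← lie_skew y z, ht, hs] at h1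
  simp only [map_neg, map_smul, LinearMap.neg_apply, LinearMap.smul_apply, S.ε_R, smul_zero,
    neg_zero, add_zero] at h1
  obtain ⟨a, b, c, habc⟩ := S.exists_of_ε_eq_zero hdim hz hz0 h1
  have h2 : S.α ⁅z, ⁅x, y⁆⁆ = 0 := by
    rw [leibniz_lie, hs, ht, smul_lie, lie_smul, S.R_lie, ← lie_skew, S.R_lie]; simp
  rw [habc] at h2
  simp only [lie_add, lie_smul, lie_self, ← lie_skew z S.R, S.R_lie, map_smul,
    neg_zero, smul_zero, zero_add, smul_eq_mul] at h2
  have hc : c = 0 := (mul_eq_zero.1 h2).resolve_right (S.lie_J_neg z hz hz0).ne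
  exact ⟨a, b, by rw [habc, hc]; simp⟩

/-- The closedness of `ε`, evaluated on `x`, `J x` and `J z`, shows that elements central modulo
the Reeb vector are stable under `J`: a real number cannot equal `i` times a real one. -/
theorem exists_lie_J_eq [LieRing.IsNilpotent L] (hdim : Module.finrank ℝ L = 5) {z : L}
    (hz : S.α z = 0) (hz0 : z ≠ 0) (hzc : ∀ x, ∃ t : ℝ, ⁅z, x⁆ = t • S.R) (x : L) :
    ∃ t : ℝ, ⁅S.J z, x⁆ = t • S.R := by
  by_cases hx : S.ε x z = 0
  · obtain ⟨a, b, c, rfl⟩ := S.exists_of_ε_eq_zero hdim hz hz0 hx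
    obtain ⟨t, ht⟩ := hzc (S.J z)
    refine ⟨-(b * t), ?_⟩
    rw [lie_add, lie_add, lie_smul, lie_smul, lie_smul, lie_self, ← lie_skew _ S.R, S.R_lie,
      ← lie_skew, ht]
    module
  · -- in `dε(x, J x, J z) = 0` the term with `⁅x, J x⁆ ∈ span {R, z}` vanishes
    have hk := S.α_toKer x
    obtain ⟨a, b, h1⟩ := S.exists_lie_eq hdim hz hz0 hzc x (S.J (S.toKer x))
    obtain ⟨a', b', h2⟩ := S.exists_lie_eq hdim hz hz0 hzc (S.J z) x
    obtain ⟨a'', b'', h3⟩ := S.exists_lie_eq hdim hz hz0 hzc (S.J (S.toKer x)) (S.J z)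
    have h := S.ε_closed x (S.J (S.toKer x)) (S.J z)
    rw [h1, h2, h3] at h
    have e1 : S.ε z (S.J z) = 0 := by rw [S.ε_J_right z z hz hz, S.ε_self, mul_zero]
    have e2 : S.ε z (S.J (S.toKer x)) = Complex.I * S.ε z x := by
      rw [S.ε_J_right _ _ hz hk, S.ε_toKer_right]
    simp only [map_add, map_smul, LinearMap.add_apply, LinearMap.smul_apply, S.ε_R, e1, e2,
      smul_zero, zero_add, Complex.real_smul] at h
    have h' : ((b'' : ℂ) + b' * Complex.I) * S.ε z x = 0 := by linear_combination h
    have h0 := (mul_eq_zero.1 h').resolve_right (by rwa [S.ε_swap, neg_eq_zero])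
    have hb : b' = 0 := by simpa using congrArg Complex.im h0
    exact ⟨a', by rw [h2, hb]; simp⟩

/-- All brackets are multiples of the Reeb vector. Otherwise some `z ∈ ker α` is central modulo `R`
and nonzero, as is `J z`, and the brackets lie in `span {R, z} ∩ span {R, J z} = span {R}`. -/
theorem lie_eq [LieRing.IsNilpotent L] (hdim : Module.finrank ℝ L = 5) (x y : L) :
    ⁅x, y⁆ = S.α ⁅x, y⁆ • S.R := by
  suffices h : ∃ t : ℝ, ⁅x, y⁆ = t • S.R by
    obtain ⟨t, ht⟩ := h
    rw [ht, map_smul, S.α_R, smul_eq_mul, mul_one]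
  by_cases hc : (LieAlgebra.center ℝ L : LieSubmodule ℝ L L) = ⊤
  · have : y ∈ (LieAlgebra.center ℝ L : LieSubmodule ℝ L L) := hc ▸ LieSubmodule.mem_top _
    exact ⟨0, by rw [zero_smul]; exact (LieModule.mem_maxTrivSubmodule ℝ L L y).1 this x⟩
  obtain ⟨z, hz, hzc⟩ := exists_notMem_lie_mem hc
  have hzR : ∀ x, ∃ t : ℝ, ⁅S.toKer z, x⁆ = t • S.R := fun x => by
    have h1 : ∀ w : L, ⁅⁅x, z⁆, w⁆ = 0 := fun w => by
      rw [← lie_skew, (LieModule.mem_maxTrivSubmodule ℝ L L _).1 (hzc x) w, neg_zero]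
    refine ⟨-S.α ⁅x, z⁆, ?_⟩
    rw [toKer, sub_lie, smul_lie, S.R_lie, ← lie_skew, neg_smul, ← S.eq_smul_R h1]
    simp
  have hk := S.α_toKer z
  have hk0 : S.toKer z ≠ 0 := by
    intro h
    refine hz ((LieModule.mem_maxTrivSubmodule ℝ L L z).2 fun w => ?_)
    rw [sub_eq_zero.1 h, lie_smul, ← lie_skew, S.R_lie]; simp
  have hJ0 : S.J (S.toKer z) ≠ 0 := by
    intro h
    have := S.J_J _ hk
    rw [h, map_zero] at this
    exact hk0 (neg_eq_zero.1 this.symm)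
  obtain ⟨a, b, h1⟩ := S.exists_lie_eq hdim hk hk0 hzR x y
  obtain ⟨a', b', h2⟩ := S.exists_lie_eq hdim (S.α_J _ hk) hJ0
    (S.exists_lie_J_eq hdim hk hk0 hzR) x y
  have hli := Fintype.linearIndependent_iff.1 (S.linearIndependent_R_self_J hk hk0)
    ![a - a', b, -b'] (by
      simp only [Fin.sum_univ_three, Matrix.cons_val_zero, Matrix.cons_val_one, Matrix.cons_val]
      rw [← sub_eq_zero.2 (h1.symm.trans h2)]; module)
  have hb : b = 0 := hli 1
  exact ⟨a, by rw [h1, hb]; simp⟩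

/-- `dα` as a bilinear form. -/
def dα : L →ₗ[ℝ] L →ₗ[ℝ] ℝ :=
  -(LieModule.toEnd ℝ L L : L →ₗ[ℝ] L →ₗ[ℝ] L).compr₂ S.α

@[simp] theorem dα_apply (x y : L) : S.dα x y = -S.α ⁅x, y⁆ := rfl

/-- Unit vectors for `dα(·, J ·)` in `ker α ∩ ker φ ∩ ker ψ`, which has positive dimension. -/
theorem exists_normalized (φ ψ : Module.Dual ℝ L) (hdim : Module.finrank ℝ L = 5) :
    ∃ w, S.α w = 0 ∧ φ w = 0 ∧ ψ w = 0 ∧ S.α ⁅w, S.J w⁆ = -1 := by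
  have : FiniteDimensional ℝ L := .of_finrank_pos (by omega)
  let f : L →ₗ[ℝ] ℝ × ℝ × ℝ := S.α.prod (φ.prod ψ)
  obtain ⟨w, hw, hw0⟩ := (LinearMap.ker f).exists_mem_ne_zero_of_ne_bot
    (LinearMap.ker_ne_bot_of_finrank_lt (by simp [hdim]))
  have hw' : S.α w = 0 ∧ φ w = 0 ∧ ψ w = 0 := by simpa [f] using hw
  have hneg := S.lie_J_neg w hw'.1 hw0
  have hpos : 0 < -S.α ⁅w, S.J w⁆ := by linarith
  refine ⟨(√(-S.α ⁅w, S.J w⁆))⁻¹ • w, by simp [hw'.1], by simp [hw'.2.1], by simp [hw'.2.2], ?_⟩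
  rw [map_smul, smul_lie, lie_smul, smul_smul, map_smul, ← mul_inv, Real.mul_self_sqrt hpos.le,
    smul_eq_mul]
  field_simp [hneg.ne]

/-- With all brackets on the Reeb line, `[x, y] = α([x, y]) R`, the Lie algebra is determined by the
symplectic form `dα` on `ker α`, and a symplectic basis `v, J v, w, J w` gives the normal form. -/
theorem isType00001234 (S : LieContactCY L) [LieRing.IsNilpotent L]
    (hdim : Module.finrank ℝ L = 5) :
    IsType00001234 L := by
  obtain ⟨v, hv, -, -, hvv⟩ := S.exists_normalized 0 0 hdim
  obtain ⟨w, hw, hvw, hJvw, hww⟩ := S.exists_normalized (S.dα v) (S.dα (S.J v)) hdim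
  have hJv := S.α_J v hv
  have hJw := S.α_J w hw
  have b1 : S.α ⁅v, w⁆ = 0 := by simpa using hvw
  have b2 : S.α ⁅S.J v, w⁆ = 0 := by simpa using hJvw
  have b3 : S.α ⁅v, S.J w⁆ = 0 := by rw [S.lie_J_symm v w hv hw, ← lie_skew, map_neg, b2, neg_zero]
  have b4 : S.α ⁅S.J v, S.J w⁆ = 0 := by
    rw [S.lie_J_symm _ _ hJv hw, S.J_J v hv, lie_neg, ← lie_skew, neg_neg, b1]
  have sk : ∀ x y, S.α ⁅y, x⁆ = -S.α ⁅x, y⁆ := fun x y => by rw [← lie_skew, map_neg]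
  have hR : ∀ y, S.α ⁅y, S.R⁆ = 0 := fun y => by rw [sk, S.α_lie_R, neg_zero]
  -- `a` is the dual basis of `e`, with covectors written through `dα`
  let e : Fin 5 → L := ![v, S.J v, w, S.J w, S.R]
  let a : Fin 5 → Module.Dual ℝ L :=
    ![-S.dα (S.J v), S.dα v, -S.dα (S.J w), S.dα w, S.α]
  have hae : ∀ i j, a i (e j) = if i = j then 1 else 0 := by
    intro i j
    fin_cases i <;> fin_cases j <;>
      simp [a, e, hv, hw, hJv, hJw, hR, S.α_R, hvv, hww, b1, b2, b3, b4, sk v w, sk (S.J v) w,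
        sk v (S.J w), sk (S.J v) (S.J w), sk v (S.J v), sk w (S.J w)]
  have hla : LinearIndependent ℝ a := by
    rw [Fintype.linearIndependent_iff]
    intro g hg j
    simpa [LinearMap.sum_apply, hae] using congrArg (fun f : Module.Dual ℝ L => f (e j)) hg
  have hle : LinearIndependent ℝ e := by
    rw [Fintype.linearIndependent_iff]
    intro g hg i
    simpa [map_sum, hae] using congrArg (a i) hg
  have hR0 : ∀ i : Fin 4, ∀ x y, covectorD (a i.castSucc) x y = 0 := by
    intro i x y
    have : a i.castSucc S.R = 0 := by
      have := hae i.castSucc (Fin.last 4)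
      rwa [if_neg (Fin.castSucc_lt_last i).ne] at this
    rw [covectorD, S.lie_eq hdim x y, map_smul, this, smul_zero, neg_zero]
  have : FiniteDimensional ℝ L := .of_finrank_pos (by omega)
  let be := basisOfLinearIndependentOfCardEqFinrank hle (by simp [hdim])
  let ba := basisOfLinearIndependentOfCardEqFinrank hla
    (by rw [Subspace.dual_finrank_eq, hdim, Fintype.card_fin])
  have hba : ⇑ba = a := coe_basisOfLinearIndependentOfCardEqFinrank _ _
  have hbe : ⇑be = e := coe_basisOfLinearIndependentOfCardEqFinrank _ _
  refine ⟨ba, ?_, ?_, ?_, ?_, fun x y => ?_⟩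
  · rw [hba]; exact hR0 0
  · rw [hba]; exact hR0 1
  · rw [hba]; exact hR0 2
  · rw [hba]; exact hR0 3
  · rw [hba]
    -- bilinear forms are compared on the basis `e`
    have key : S.dα = (a 0).smulRight (a 1) - (a 1).smulRight (a 0)
        + ((a 2).smulRight (a 3) - (a 3).smulRight (a 2)) := by
      refine LinearMap.ext_basis be be fun i j => ?_
      simp only [hbe, LinearMap.add_apply, LinearMap.sub_apply, LinearMap.smulRight_apply,
        LinearMap.smul_apply, hae]
      fin_cases i <;> fin_cases j <;>
        simp [e, hR, S.α_lie_R, hvv, hww, b1, b2, b3, b4, sk v w, sk (S.J v) w,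
          sk v (S.J w), sk (S.J v) (S.J w), sk v (S.J v), sk w (S.J w)]
    have h := congrArg (fun B : L →ₗ[ℝ] L →ₗ[ℝ] ℝ => B x y) key
    simp only [LinearMap.add_apply, LinearMap.sub_apply, LinearMap.smulRight_apply,
      LinearMap.smul_apply, smul_eq_mul, dα_apply] at h
    change -S.α ⁅x, y⁆ = a 0 x * a 1 y - a 0 y * a 1 x + (a 2 x * a 3 y - a 2 y * a 3 x)
    rw [h]; ring

end LieContactCY

end Algebra

/-! ### Left-invariant fields in a chart -/

section Geometry

variable {G : Type*} [Group G] [TopologicalSpace G]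
  {E : Type*} [NormedAddCommGroup E] [NormedSpace ℝ E] [ChartedSpace E G]

theorem DForm.IsLeftInvariant.apply_mulInvariantVectorField {F : Type*} [NormedAddCommGroup F]
    [NormedSpace ℝ F] {k : ℕ} {γ : DForm E F G k} (hγ : γ.IsLeftInvariant) (g : G)
    (v : Fin k → GroupLieAlgebra 𝓘(ℝ, E) G) :
    γ g (fun i => mulInvariantVectorField (v i) g) = γ 1 v := by
  have h := congrArg (fun f => f v) (congrFun (hγ g) 1)
  refine Eq.trans ?_ h
  -- the points `g` and `g * 1` agree only propositionally
  have key : ∀ h : G, h = g → ∀ u : Fin k → E,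
      (γ g : E [⋀^Fin k]→L[ℝ] F) u = (γ h : E [⋀^Fin k]→L[ℝ] F) u := by
    rintro _ rfl _; rfl
  exact key (g * 1) (mul_one g) _

section Lift

variable [IsTopologicalGroup G] [T2Space G] [LocallyCompactSpace G]
  {Γ : Subgroup G} [DiscreteTopology Γ] {a : G}

/-- The tangent map at `a` of the projection, precomposed with left translation by `a`. -/
def liftTangent (Γ : Subgroup G) [DiscreteTopology Γ] (a : G) :
    GroupLieAlgebra 𝓘(ℝ, E) G →L[ℝ] TangentSpace 𝓘(ℝ, E) (proj Γ a) :=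
  let A : TangentSpace 𝓘(ℝ, E) (1 : G) →L[ℝ] TangentSpace 𝓘(ℝ, E) a :=
    mfderiv 𝓘(ℝ, E) 𝓘(ℝ, E) (fun x => a * x) (1 : G)
  mfderiv 𝓘(ℝ, E) 𝓘(ℝ, E) (proj Γ) a ∘L A

theorem liftTangent_apply (v : GroupLieAlgebra 𝓘(ℝ, E) G) :
    liftTangent Γ a v =
      mfderiv 𝓘(ℝ, E) 𝓘(ℝ, E) (proj Γ) a (mulInvariantVectorField v a) := rfl

theorem apply_liftTangent {F : Type*} [NormedAddCommGroup F] [NormedSpace ℝ F] {k : ℕ}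
    {γ : DForm E F (LeftQuotient Γ) k} (hγ : (γ.pullback (proj Γ)).IsLeftInvariant)
    (v : Fin k → GroupLieAlgebra 𝓘(ℝ, E) G) :
    γ (proj Γ a) (fun i => liftTangent Γ a (v i)) = γ.pullback (proj Γ) 1 v :=
  hγ.apply_mulInvariantVectorField a v

end Lift

/-- Around every point of the quotient, the preferred chart is the preferred chart of `G` at some
preimage, read through the projection. -/
theorem exists_chart_eq [IsTopologicalGroup G] [T2Space G] [LocallyCompactSpace G]
    (Γ : Subgroup G) [DiscreteTopology Γ] (x : LeftQuotient Γ) :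
    ∃ a : G, proj Γ a = x ∧
      (⇑(extChartAt 𝓘(ℝ, E) x).symm = proj Γ ∘ (extChartAt 𝓘(ℝ, E) a).symm) ∧
      extChartAt 𝓘(ℝ, E) x x = extChartAt 𝓘(ℝ, E) a a := by
  have hf : IsLocalHomeomorph (proj Γ) :=
    (isQuotientCoveringMap_quotientMk_of_properlyDiscontinuousSMul
      (G := Γ) (E := G)).isCoveringMap.isLocalHomeomorph
  let hr := (Quotient.mk_surjective (s := MulAction.orbitRel Γ G)).hasRightInverse
  have ha : proj Γ (hr.choose x) = x := hr.choose_spec x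
  -- by definition the chart at `x` is a local inverse of the projection followed by a chart of `G`
  refine ⟨hr.choose x, ha, ?_, ?_⟩
  · have : ⇑(hf.localInverseAt (hr.choose x)).symm = proj Γ := hf.localInverseAt_symm _
    have h2 : (⇑(extChartAt 𝓘(ℝ, E) x).symm : E → LeftQuotient Γ) =
      (hf.localInverseAt (hr.choose x)).symm ∘ (chartAt E (hr.choose x)).symm := rfl
    rw [h2, this]; rfl
  · have h2 : extChartAt 𝓘(ℝ, E) x x =
      (chartAt E (hr.choose x)) (hf.localInverseAt (hr.choose x) x) := rfl
    have h3 : hf.localInverseAt (hr.choose x) x = hr.choose x :=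
      (congrArg _ ha.symm).trans hf.localInverseAt_apply_self
    rw [h2, h3]; rfl

theorem isInvertible_mfderiv_extChartAt_symm {M : Type*} [TopologicalSpace M] [ChartedSpace E M]
    [IsManifold 𝓘(ℝ, E) 1 M] {x : M} {y : E} (hy : y ∈ (extChartAt 𝓘(ℝ, E) x).target) :
    (mfderiv 𝓘(ℝ, E) 𝓘(ℝ, E) (extChartAt 𝓘(ℝ, E) x).symm y).IsInvertible := by
  simpa using isInvertible_mfderivWithin_extChartAt_symm hy

/-- The left-invariant vector field of `G` with value `v` at the identity, read in the preferred
chart at `a`. -/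
def chartField (a : G) (v : GroupLieAlgebra 𝓘(ℝ, E) G) : E → E :=
  VectorField.mpullback 𝓘(ℝ, E) 𝓘(ℝ, E) (extChartAt 𝓘(ℝ, E) a).symm (mulInvariantVectorField v)

theorem contMDiffAt_extChartAt_symm {M : Type*} [TopologicalSpace M] [ChartedSpace E M]
    [IsManifold 𝓘(ℝ, E) ∞ M] {a : M} {y : E}
    (hy : y ∈ (extChartAt 𝓘(ℝ, E) a).target) :
    ContMDiffAt 𝓘(ℝ, E) 𝓘(ℝ, E) ∞ (extChartAt 𝓘(ℝ, E) a).symm y :=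
  (contMDiffOn_extChartAt_symm (n := ∞) a).contMDiffAt
    ((isOpen_extChartAt_target a).mem_nhds hy)

variable [LieGroup 𝓘(ℝ, E) ∞ G]

theorem eq_zero_of_mulInvariantVectorField_eq_zero {v : GroupLieAlgebra 𝓘(ℝ, E) G} {g : G}
    (h : mulInvariantVectorField v g = 0) : v = 0 := by
  have h1 := congrFun (mpullback_mulInvariantVectorField g v) 1
  have h2 : mulInvariantVectorField v (g * 1) = 0 := by rw [mul_one, h]
  rw [VectorField.mpullback_apply, h2, map_zero] at h1
  have h3 : mulInvariantVectorField v (1 : G) = v := by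
    have : (fun x : G => 1 * x) = id := funext one_mul
    rw [mulInvariantVectorField, this, mfderiv_id]
    rfl
  rw [← h3, ← h1]

theorem mfderiv_chartField {a : G} (v : GroupLieAlgebra 𝓘(ℝ, E) G) {y : E}
    (hy : y ∈ (extChartAt 𝓘(ℝ, E) a).target) :
    mfderiv 𝓘(ℝ, E) 𝓘(ℝ, E) (extChartAt 𝓘(ℝ, E) a).symm y (chartField (E := E) a v y) =
      mulInvariantVectorField v ((extChartAt 𝓘(ℝ, E) a).symm y) :=
  (isInvertible_mfderiv_extChartAt_symm hy).self_apply_inverse _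

theorem differentiableAt_chartField [CompleteSpace E] {a : G}
    (v : GroupLieAlgebra 𝓘(ℝ, E) G) {y : E}
    (hy : y ∈ (extChartAt 𝓘(ℝ, E) a).target) :
    DifferentiableAt ℝ (chartField a v) y := by
  have h := ContMDiffAt.mpullback_vectorField_preimage (m := 1) (n := ∞)
    (f := (extChartAt 𝓘(ℝ, E) a).symm) (x₀ := y)
    ((contMDiffAt_mulInvariantVectorField v).of_le (by simp))
    (contMDiffAt_extChartAt_symm hy) (isInvertible_mfderiv_extChartAt_symm hy)
    (by norm_cast)
  exact (contMDiffAt_vectorSpace_iff_contDiffAt.1 h).differentiableAt one_ne_zero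

theorem lieBracket_chartField [CompleteSpace E] {a : G}
    (v w : GroupLieAlgebra 𝓘(ℝ, E) G) {y : E}
    (hy : y ∈ (extChartAt 𝓘(ℝ, E) a).target) :
    VectorField.lieBracket ℝ (chartField a v) (chartField a w) y = chartField a ⁅v, w⁆ y := by
  have h := VectorField.mpullback_mlieBracket (n := ∞)
    (f := (extChartAt 𝓘(ℝ, E) a).symm) (x₀ := y)
    (mdifferentiableAt_mulInvariantVectorField v) (mdifferentiableAt_mulInvariantVectorField w)
    (contMDiffAt_extChartAt_symm hy) (by simp; norm_cast)
  rw [← mulInvariantVector_mlieBracket, ← VectorField.mlieBracketWithin_univ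
    (I := 𝓘(ℝ, E)) (M := E), VectorField.mlieBracketWithin_eq_lieBracketWithin] at h
  rw [← VectorField.lieBracketWithin_univ]
  exact h.symm

/-! ### The exterior derivative of an invariant form on the quotient -/

section Chart

-- Below, `hs` and `ha` say that the preferred chart at `proj Γ a` is the one at `a` read through the
-- projection; by `exists_chart_eq` every point of the quotient has such a preimage `a`.
variable [IsTopologicalGroup G] [T2Space G] [LocallyCompactSpace G]
  {Γ : Subgroup G} [DiscreteTopology Γ] {a : G}

theorem mdifferentiableAt_proj
    (hs : ⇑(extChartAt 𝓘(ℝ, E) (proj Γ a)).symm = proj Γ ∘ (extChartAt 𝓘(ℝ, E) a).symm)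
    {g : G} (hg : g ∈ (extChartAt 𝓘(ℝ, E) a).source)
    (hg' : extChartAt 𝓘(ℝ, E) a g ∈ (extChartAt 𝓘(ℝ, E) (proj Γ a)).target) :
    MDifferentiableAt 𝓘(ℝ, E) 𝓘(ℝ, E) (proj Γ) g := by
  have h1 : MDifferentiableAt 𝓘(ℝ, E) 𝓘(ℝ, E) (extChartAt 𝓘(ℝ, E) (proj Γ a)).symm
      (extChartAt 𝓘(ℝ, E) a g) :=
    mdifferentiableAt_of_isInvertible_mfderiv (isInvertible_mfderiv_extChartAt_symm hg')
  have h2 : MDifferentiableAt 𝓘(ℝ, E) 𝓘(ℝ, E) (extChartAt 𝓘(ℝ, E) a) g :=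
    mdifferentiableAt_extChartAt (by simpa using hg)
  refine (h1.comp g h2).congr_of_eventuallyEq ?_
  filter_upwards [(isOpen_extChartAt_source a).mem_nhds hg] with x hx
  rw [hs, Function.comp_apply, Function.comp_apply, (extChartAt 𝓘(ℝ, E) a).left_inv hx]

/-- The chart of the quotient takes the chart expression of a left-invariant field to its
image under the projection. -/
theorem mfderiv_symm_chartField
    (hs : ⇑(extChartAt 𝓘(ℝ, E) (proj Γ a)).symm = proj Γ ∘ (extChartAt 𝓘(ℝ, E) a).symm)
    {y : E} (v : GroupLieAlgebra 𝓘(ℝ, E) G)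
    (hy : y ∈ (extChartAt 𝓘(ℝ, E) a).target)
    (hy' : y ∈ (extChartAt 𝓘(ℝ, E) (proj Γ a)).target) :
    (mfderiv 𝓘(ℝ, E) 𝓘(ℝ, E) (extChartAt 𝓘(ℝ, E) (proj Γ a)).symm y
      (chartField (E := E) a v y) : E) =
      mfderiv 𝓘(ℝ, E) 𝓘(ℝ, E) (proj Γ) ((extChartAt 𝓘(ℝ, E) a).symm y)
        (mulInvariantVectorField v ((extChartAt 𝓘(ℝ, E) a).symm y)) := by
  rw [← mfderiv_chartField v hy, hs, mfderiv_comp (I' := 𝓘(ℝ, E)) y _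
    (mdifferentiableAt_of_isInvertible_mfderiv (isInvertible_mfderiv_extChartAt_symm hy))]
  · rfl
  · exact mdifferentiableAt_proj hs ((extChartAt 𝓘(ℝ, E) a).map_target hy)
      (by rwa [(extChartAt 𝓘(ℝ, E) a).right_inv hy])

/-- An invariant form on the quotient is constant on left-invariant fields, also in the chart. -/
theorem inChart_chartField {F : Type*} [NormedAddCommGroup F] [NormedSpace ℝ F] {k : ℕ}
    (hs : ⇑(extChartAt 𝓘(ℝ, E) (proj Γ a)).symm = proj Γ ∘ (extChartAt 𝓘(ℝ, E) a).symm)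
    {γ : DForm E F (LeftQuotient Γ) k} (hγ : (γ.pullback (proj Γ)).IsLeftInvariant) {y : E}
    (v : Fin k → GroupLieAlgebra 𝓘(ℝ, E) G) (hy : y ∈ (extChartAt 𝓘(ℝ, E) a).target)
    (hy' : y ∈ (extChartAt 𝓘(ℝ, E) (proj Γ a)).target) :
    γ.inChart (proj Γ a) y (fun i => chartField a (v i) y) = γ.pullback (proj Γ) 1 v := by
  rw [← hγ.apply_mulInvariantVectorField ((extChartAt 𝓘(ℝ, E) a).symm y)]
  have h1 := congrFun hs y
  have h2 := fun i => mfderiv_symm_chartField hs (v i) hy hy'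
  have key : ∀ p q : LeftQuotient Γ, p = q → ∀ u w : Fin k → E, u = w →
      (γ p : E [⋀^Fin k]→L[ℝ] F) u = (γ q : E [⋀^Fin k]→L[ℝ] F) w := by
    rintro _ _ rfl _ _ rfl; rfl
  exact key _ _ h1 _ _ (funext h2)

theorem mfderiv_extChartAt_liftTangent
    (hs : ⇑(extChartAt 𝓘(ℝ, E) (proj Γ a)).symm = proj Γ ∘ (extChartAt 𝓘(ℝ, E) a).symm)
    (ha : extChartAt 𝓘(ℝ, E) (proj Γ a) (proj Γ a) = extChartAt 𝓘(ℝ, E) a a)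
    (v : GroupLieAlgebra 𝓘(ℝ, E) G) :
    (mfderiv 𝓘(ℝ, E) 𝓘(ℝ, E) (extChartAt 𝓘(ℝ, E) (proj Γ a)) (proj Γ a)
      (liftTangent Γ a v) : E) = chartField a v (extChartAt 𝓘(ℝ, E) a a) := by
  have hy : extChartAt 𝓘(ℝ, E) a a ∈ (extChartAt 𝓘(ℝ, E) a).target := mem_extChartAt_target a
  have hy' : extChartAt 𝓘(ℝ, E) a a ∈ (extChartAt 𝓘(ℝ, E) (proj Γ a)).target :=
    ha ▸ mem_extChartAt_target (proj Γ a)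
  have h1 := mfderiv_symm_chartField hs v hy hy'
  rw [extChartAt_to_inv] at h1
  have h2 := congrArg (fun f => f (chartField (E := E) a v (extChartAt 𝓘(ℝ, E) a a)))
    (mfderiv_extChartAt_comp_mfderivWithin_extChartAt_symm (I := 𝓘(ℝ, E)) (x := proj Γ a) hy')
  rw [liftTangent_apply, ← h1]
  simp only [modelWithCornersSelf_coe, Set.range_id, mfderivWithin_univ] at h2
  refine Eq.trans ?_ h2
  have key : ∀ p q : LeftQuotient Γ, p = q → ∀ u : E,
      (mfderiv 𝓘(ℝ, E) 𝓘(ℝ, E) (extChartAt 𝓘(ℝ, E) (proj Γ a)) p : E →L[ℝ] E) u =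
      (mfderiv 𝓘(ℝ, E) 𝓘(ℝ, E) (extChartAt 𝓘(ℝ, E) (proj Γ a)) q : E →L[ℝ] E) u := by
    rintro _ _ rfl _; rfl
  refine key _ _ ?_ _
  rw [hs, Function.comp_apply, extChartAt_to_inv]

theorem liftTangent_injective
    (hs : ⇑(extChartAt 𝓘(ℝ, E) (proj Γ a)).symm = proj Γ ∘ (extChartAt 𝓘(ℝ, E) a).symm)
    (ha : extChartAt 𝓘(ℝ, E) (proj Γ a) (proj Γ a) = extChartAt 𝓘(ℝ, E) a a) :
    Function.Injective (liftTangent (E := E) Γ a) := by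
  rw [injective_iff_map_eq_zero]
  intro v hv
  have h1 := mfderiv_extChartAt_liftTangent hs ha v
  rw [hv, map_zero] at h1
  have h2 := mfderiv_chartField v (mem_extChartAt_target (I := 𝓘(ℝ, E)) a)
  rw [← h1, extChartAt_to_inv] at h2
  exact eq_zero_of_mulInvariantVectorField_eq_zero (h2.symm.trans (map_zero _))

/-- On left-invariant fields the derivatives in the invariant formula for the exterior
derivative vanish, so that only the bracket terms are left. -/
theorem d_apply_liftTangent [CompleteSpace E] {F : Type*} [NormedAddCommGroup F]
    [NormedSpace ℝ F] {n : ℕ}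
    (hs : ⇑(extChartAt 𝓘(ℝ, E) (proj Γ a)).symm = proj Γ ∘ (extChartAt 𝓘(ℝ, E) a).symm)
    (ha : extChartAt 𝓘(ℝ, E) (proj Γ a) (proj Γ a) = extChartAt 𝓘(ℝ, E) a a)
    {γ : DForm E F (LeftQuotient Γ) (n + 1)} (hsm : γ.Smooth)
    (hγ : (γ.pullback (proj Γ)).IsLeftInvariant) (v : Fin (n + 2) → GroupLieAlgebra 𝓘(ℝ, E) G) :
    γ.d (proj Γ a) (fun i => liftTangent Γ a (v i)) =
      -∑ i : Fin (n + 1), ∑ j ≥ i, (-1) ^ (i + j : ℕ) •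
        γ (proj Γ a) (fun k => liftTangent Γ a
          (Matrix.vecCons ⁅v i.castSucc, v j.succ⁆ (j.removeNth (i.castSucc.removeNth v)) k)) := by
  set y := extChartAt 𝓘(ℝ, E) a a with hy_def
  have hy : y ∈ (extChartAt 𝓘(ℝ, E) a).target := mem_extChartAt_target a
  have hy' : y ∈ (extChartAt 𝓘(ℝ, E) (proj Γ a)).target :=
    ha ▸ mem_extChartAt_target (proj Γ a)
  have hdiff : DifferentiableAt ℝ (γ.inChart (proj Γ a)) y :=
    ((hsm (proj Γ a)).contDiffAt ((isOpen_extChartAt_target _).mem_nhds hy')).differentiableAt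
      (by simp)
  have h := extDeriv_apply_vectorField hdiff
    (V := fun i => chartField a (v i)) fun i => differentiableAt_chartField (v i) hy
  have hconst : ∀ w : Fin (n + 1) → GroupLieAlgebra 𝓘(ℝ, E) G,
      fderiv ℝ (fun x => γ.inChart (proj Γ a) x (fun k => chartField a (w k) x)) y = 0 := by
    intro w
    have : (fun x => γ.inChart (proj Γ a) x (fun k => chartField a (w k) x)) =ᶠ[𝓝 y]
        fun _ => γ.pullback (proj Γ) 1 w := by
      filter_upwards [(isOpen_extChartAt_target a).mem_nhds hy,
        (isOpen_extChartAt_target (proj Γ a)).mem_nhds hy'] with x hx hx'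
      exact inChart_chartField hs hγ w hx hx'
    rw [this.fderiv_eq, fderiv_fun_const]; rfl
  have hcons : ∀ (u : GroupLieAlgebra 𝓘(ℝ, E) G) (w : Fin n → GroupLieAlgebra 𝓘(ℝ, E) G),
      Matrix.vecCons (chartField a u y) (fun k => chartField a (w k) y) =
        fun k => chartField a (Matrix.vecCons u w k) y := by
    intro u w
    funext k
    refine Fin.cases ?_ (fun k => ?_) k <;> simp
  have hd : γ.d (proj Γ a) (fun i => liftTangent Γ a (v i)) =
      extDeriv (γ.inChart (proj Γ a)) y (fun i => chartField a (v i) y) := by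
    have h1 : (fun i => chartField a (v i) y) = fun i =>
        (mfderiv 𝓘(ℝ, E) 𝓘(ℝ, E) (extChartAt 𝓘(ℝ, E) (proj Γ a)) (proj Γ a)
          (liftTangent Γ a (v i)) : E) :=
      funext fun i => (mfderiv_extChartAt_liftTangent hs ha (v i)).symm
    rw [h1, ← ha]
    rfl
  rw [hd, h, Finset.sum_eq_zero, zero_sub]
  · congr 1
    refine Finset.sum_congr rfl fun i _ => Finset.sum_congr rfl fun j _ => ?_
    rw [lieBracket_chartField _ _ hy, apply_liftTangent hγ, ← inChart_chartField hs hγ _ hy hy',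
      ← hcons]
    rfl
  · intro i _
    have := hconst (i.removeNth v)
    have h2 : fderiv ℝ (fun x => γ.inChart (proj Γ a) x
      (i.removeNth fun k => chartField a (v k) x)) y = 0 := this
    rw [h2]
    simp

end Chart

end Geometry
/-! ### Forms of degree one and two -/

section Forms

variable {V F : Type*} [AddCommGroup V] [Module ℝ V] [TopologicalSpace V]
  [NormedAddCommGroup F] [NormedSpace ℝ F]

/-- An alternating 1-form as a linear map. -/
def oneForm (f : V [⋀^Fin 1]→L[ℝ] F) : V →ₗ[ℝ] F where
  toFun v := f ![v]
  map_add' v w := f.toAlternatingMap.map_vecCons_add ![] v w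
  map_smul' c v := f.toAlternatingMap.map_vecCons_smul ![] c v

/-- An alternating 2-form as a bilinear map. -/
def twoForm (f : V [⋀^Fin 2]→L[ℝ] F) : V →ₗ[ℝ] V →ₗ[ℝ] F :=
  have swap : ∀ v w, f ![v, w] = -f ![w, v] := fun v w => by
    have := f.toAlternatingMap.map_swap ![w, v] (i := 0) (j := 1) (by decide)
    refine Eq.trans (congrArg f ?_) this
    ext i; fin_cases i <;> rfl
  LinearMap.mk₂ ℝ (fun v w => f ![v, w])
    (fun v w u => f.toAlternatingMap.map_vecCons_add ![u] v w)
    (fun c v w => f.toAlternatingMap.map_vecCons_smul ![w] c v)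
    (fun v w u => by
      rw [swap, swap v w, swap v u, ← neg_add]
      exact congrArg _ (f.toAlternatingMap.map_vecCons_add ![v] w u))
    (fun c v w => by
      rw [swap, swap v w, smul_neg]
      exact congrArg _ (f.toAlternatingMap.map_vecCons_smul ![v] c w))

theorem twoForm_apply (f : V [⋀^Fin 2]→L[ℝ] F) (v w : V) : twoForm f v w = f ![v, w] := rfl

theorem twoForm_self (f : V [⋀^Fin 2]→L[ℝ] F) (v : V) : twoForm f v v = 0 :=
  f.map_eq_zero_of_eq ![v, v] (i := 0) (j := 1) rfl (by decide)

end Forms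

section Geometry

variable {G : Type*} [Group G] [TopologicalSpace G]
  {E : Type*} [NormedAddCommGroup E] [NormedSpace ℝ E] [ChartedSpace E G]
  [LieGroup 𝓘(ℝ, E) ∞ G] [CompleteSpace E]
  [IsTopologicalGroup G] [T2Space G] [LocallyCompactSpace G]
  {Γ : Subgroup G} [DiscreteTopology Γ] {a : G}
  {F : Type*} [NormedAddCommGroup F] [NormedSpace ℝ F]

theorem d_oneForm_liftTangent
    (hs : ⇑(extChartAt 𝓘(ℝ, E) (proj Γ a)).symm = proj Γ ∘ (extChartAt 𝓘(ℝ, E) a).symm)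
    (ha : extChartAt 𝓘(ℝ, E) (proj Γ a) (proj Γ a) = extChartAt 𝓘(ℝ, E) a a)
    {γ : DForm E F (LeftQuotient Γ) 1} (hsm : γ.Smooth)
    (hγ : (γ.pullback (proj Γ)).IsLeftInvariant) (v w : GroupLieAlgebra 𝓘(ℝ, E) G) :
    γ.d (proj Γ a) ![liftTangent Γ a v, liftTangent Γ a w] =
      -γ (proj Γ a) ![liftTangent Γ a ⁅v, w⁆] := by
  have h := d_apply_liftTangent hs ha hsm hγ ![v, w]
  have e1 : (fun i => liftTangent Γ a (![v, w] i)) = ![liftTangent Γ a v, liftTangent Γ a w] := by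
    funext i; fin_cases i <;> rfl
  rw [e1] at h
  rw [h]
  -- restated over `Fin 1`, which so far is written `Fin (0 + 1)`
  change -∑ i : Fin 1, ∑ j ≥ i, (-1) ^ (i + j : ℕ) • γ (proj Γ a) (fun k => liftTangent Γ a
    (Matrix.vecCons ⁅![v, w] i.castSucc, ![v, w] j.succ⁆
      (j.removeNth (i.castSucc.removeNth ![v, w])) k)) = _
  have s0 : Finset.Ici (0 : Fin 1) = {0} := by decide
  have c0 : (fun k => liftTangent Γ a
      (Matrix.vecCons ⁅![v, w] (Fin.castSucc 0), ![v, w] (Fin.succ 0)⁆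
      (Fin.removeNth 0 (Fin.removeNth (Fin.castSucc 0) ![v, w])) k)) =
      ![liftTangent Γ a ⁅v, w⁆] := by
    funext k; fin_cases k; rfl
  simp only [Fin.sum_univ_one, s0, Finset.sum_singleton, c0]
  simp

theorem d_twoForm_liftTangent
    (hs : ⇑(extChartAt 𝓘(ℝ, E) (proj Γ a)).symm = proj Γ ∘ (extChartAt 𝓘(ℝ, E) a).symm)
    (ha : extChartAt 𝓘(ℝ, E) (proj Γ a) (proj Γ a) = extChartAt 𝓘(ℝ, E) a a)
    {γ : DForm E F (LeftQuotient Γ) 2} (hsm : γ.Smooth)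
    (hγ : (γ.pullback (proj Γ)).IsLeftInvariant) (u v w : GroupLieAlgebra 𝓘(ℝ, E) G) :
    γ.d (proj Γ a) ![liftTangent Γ a u, liftTangent Γ a v, liftTangent Γ a w] =
      -(γ (proj Γ a) ![liftTangent Γ a ⁅u, v⁆, liftTangent Γ a w] -
        γ (proj Γ a) ![liftTangent Γ a ⁅u, w⁆, liftTangent Γ a v] +
        γ (proj Γ a) ![liftTangent Γ a ⁅v, w⁆, liftTangent Γ a u]) := by
  have h := d_apply_liftTangent hs ha hsm hγ ![u, v, w]
  have e1 : (fun i => liftTangent Γ a (![u, v, w] i)) =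
      ![liftTangent Γ a u, liftTangent Γ a v, liftTangent Γ a w] := by
    funext i; fin_cases i <;> rfl
  rw [e1] at h
  rw [h]
  -- restated over `Fin 2`, which so far is written `Fin (1 + 1)`
  change -∑ i : Fin 2, ∑ j ≥ i, (-1) ^ (i + j : ℕ) • γ (proj Γ a) (fun k => liftTangent Γ a
    (Matrix.vecCons ⁅![u, v, w] i.castSucc, ![u, v, w] j.succ⁆
      (j.removeNth (i.castSucc.removeNth ![u, v, w])) k)) = _
  have s0 : Finset.Ici (0 : Fin 2) = {0, 1} := by decide
  have s1 : Finset.Ici (1 : Fin 2) = {1} := by decide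
  have c00 : (fun k => liftTangent Γ a
      (Matrix.vecCons ⁅![u, v, w] (Fin.castSucc 0), ![u, v, w] (Fin.succ 0)⁆
      (Fin.removeNth 0 (Fin.removeNth (Fin.castSucc 0) ![u, v, w])) k)) =
      ![liftTangent Γ a ⁅u, v⁆, liftTangent Γ a w] := by
    funext k; fin_cases k <;> rfl
  have c01 : (fun k => liftTangent Γ a
      (Matrix.vecCons ⁅![u, v, w] (Fin.castSucc 0), ![u, v, w] (Fin.succ 1)⁆
      (Fin.removeNth 1 (Fin.removeNth (Fin.castSucc 0) ![u, v, w])) k)) =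
      ![liftTangent Γ a ⁅u, w⁆, liftTangent Γ a v] := by
    funext k; fin_cases k <;> rfl
  have c11 : (fun k => liftTangent Γ a
      (Matrix.vecCons ⁅![u, v, w] (Fin.castSucc 1), ![u, v, w] (Fin.succ 1)⁆
      (Fin.removeNth 1 (Fin.removeNth (Fin.castSucc 1) ![u, v, w])) k)) =
      ![liftTangent Γ a ⁅v, w⁆, liftTangent Γ a u] := by
    funext k; fin_cases k <;> rfl
  simp only [Fin.sum_univ_two, s0, s1, Finset.sum_pair zero_ne_one, Finset.sum_singleton,
    c00, c01, c11]
  simp [sub_eq_add_neg]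

/-! ### The structure induced on the Lie algebra -/

/-- The values of an invariant contact Calabi–Yau structure at one point, transported to the Lie
algebra. -/
theorem ContactCalabiYau5.IsInvariant.nonempty_lieContactCY [FiniteDimensional ℝ E]
    {S : ContactCalabiYau5 E (LeftQuotient Γ)} (hS : S.IsInvariant) :
    Nonempty (LieContactCY (GroupLieAlgebra 𝓘(ℝ, E) G)) := by
  obtain ⟨hα, -, hε⟩ := hS
  obtain ⟨a, -, hs, ha⟩ : ∃ a : G, proj Γ a = proj Γ 1 ∧
      ⇑(extChartAt 𝓘(ℝ, E) (proj Γ a)).symm = proj Γ ∘ (extChartAt 𝓘(ℝ, E) a).symm ∧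
      extChartAt 𝓘(ℝ, E) (proj Γ a) (proj Γ a) = extChartAt 𝓘(ℝ, E) a a := by
    obtain ⟨a, h, h1, h2⟩ := exists_chart_eq (E := E) Γ (proj Γ 1)
    exact ⟨a, h, by rw [h, h1], by rw [h, h2]⟩
  have : FiniteDimensional ℝ (GroupLieAlgebra 𝓘(ℝ, E) G) := inferInstanceAs (FiniteDimensional ℝ E)
  have : FiniteDimensional ℝ (TangentSpace 𝓘(ℝ, E) (proj Γ a)) :=
    inferInstanceAs (FiniteDimensional ℝ E)
  let e : GroupLieAlgebra 𝓘(ℝ, E) G ≃ₗ[ℝ] TangentSpace 𝓘(ℝ, E) (proj Γ a) :=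
    LinearMap.linearEquivOfInjective (liftTangent Γ a).toLinearMap (liftTangent_injective hs ha) rfl
  have he : ∀ v, liftTangent Γ a v = e v := fun v => rfl
  have hdα : ∀ v w, S.α.d (proj Γ a) ![e v, e w] = -S.α (proj Γ a) ![e ⁅v, w⁆] :=
    d_oneForm_liftTangent hs ha S.sasakian.contact.1 hα
  have hκ : ∀ v w, kappa S.α (proj Γ a) ![e v, e w] = -(1 / 2) * S.α (proj Γ a) ![e ⁅v, w⁆] := by
    intro v w
    have : kappa S.α (proj Γ a) ![e v, e w] = (1 / 2) * S.α.d (proj Γ a) ![e v, e w] := rfl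
    rw [this, hdα]; ring
  have hdε : ∀ u v w, S.ε (proj Γ a) ![e ⁅u, v⁆, e w] - S.ε (proj Γ a) ![e ⁅u, w⁆, e v] +
      S.ε (proj Γ a) ![e ⁅v, w⁆, e u] = 0 := by
    intro u v w
    have := d_twoForm_liftTangent hs ha S.smooth hε u v w
    rw [S.closed] at this
    simp only [he] at this
    exact neg_eq_zero.1 this.symm
  have hcal := S.sasakian.calibrated
  let J : GroupLieAlgebra 𝓘(ℝ, E) G →ₗ[ℝ] GroupLieAlgebra 𝓘(ℝ, E) G :=
    e.symm.toLinearMap ∘ₗ (S.J (proj Γ a)).toLinearMap ∘ₗ e.toLinearMap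
  have hJ : ∀ v, e (J v) = S.J (proj Γ a) (e v) := fun v => e.apply_symm_apply _
  refine ⟨{
    α := oneForm (S.α (proj Γ a)) ∘ₗ e.toLinearMap
    R := e.symm (S.R (proj Γ a))
    J := J
    ε := (twoForm (S.ε (proj Γ a))).compl₁₂ e.toLinearMap e.toLinearMap
    α_R := ?_
    α_lie_R := ?_
    α_J := ?_
    J_J := ?_
    lie_J_symm := ?_
    lie_J_neg := ?_
    ε_self := fun v => twoForm_self _ _
    ε_R := ?_
    ε_J := ?_
    ε_ne := ?_
    ε_closed := ?_ }⟩
  · change S.α (proj Γ a) ![e (e.symm _)] = 1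
    rw [e.apply_symm_apply]
    exact (S.sasakian.reeb _).1
  · intro v
    change S.α (proj Γ a) ![e ⁅_, _⁆] = 0
    rw [← neg_eq_zero, ← hdα, e.apply_symm_apply]
    exact (S.sasakian.reeb _).2 _
  · intro v hv
    change S.α (proj Γ a) ![e (J v)] = 0
    rw [hJ]
    exact hcal.mem_ker _ _ hv
  · intro v hv
    apply e.injective
    rw [hJ, hJ, map_neg]
    exact hcal.sq _ _ hv
  · intro v w hv hw
    change S.α (proj Γ a) ![e ⁅v, J w⁆] = S.α (proj Γ a) ![e ⁅w, J v⁆]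
    have := hcal.symm _ _ _ hv hw
    simp only [LinearEquiv.coe_coe, ← hJ, hκ] at this
    linarith
  · intro v hv hv0
    change S.α (proj Γ a) ![e ⁅v, J v⁆] < 0
    have := hcal.pos _ _ hv (e.map_ne_zero_iff.2 hv0)
    simp only [LinearEquiv.coe_coe, ← hJ, hκ] at this
    linarith
  · intro v
    change S.ε (proj Γ a) ![e (e.symm _), e v] = 0
    rw [e.apply_symm_apply]
    exact congrArg (fun f => f ![e v]) (S.contract_reeb (proj Γ a))
  · intro v w hv hw
    change S.ε (proj Γ a) ![e (J v), e w] = Complex.I * S.ε (proj Γ a) ![e v, e w]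
    rw [hJ]
    exact S.type_two_zero _ _ _ hv hw
  · intro h
    refine S.ne_zero (proj Γ a) ?_
    ext v
    have h1 := congrArg (fun B => B (e.symm (v 0)) (e.symm (v 1))) h
    have h2 : S.ε (proj Γ a) ![e (e.symm (v 0)), e (e.symm (v 1))] = 0 := h1
    rw [e.apply_symm_apply, e.apply_symm_apply] at h2
    refine Eq.trans (congrArg _ ?_) h2
    funext i; fin_cases i <;> rfl
  · intro u v w
    change S.ε (proj Γ a) ![e ⁅u, v⁆, e w] + S.ε (proj Γ a) ![e ⁅v, w⁆, e u] +
      S.ε (proj Γ a) ![e ⁅w, u⁆, e v] = 0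
    have h1 : S.ε (proj Γ a) ![e ⁅w, u⁆, e v] = -S.ε (proj Γ a) ![e ⁅u, w⁆, e v] := by
      rw [← lie_skew, map_neg, ← twoForm_apply, ← twoForm_apply, map_neg, LinearMap.neg_apply]
    rw [h1]
    linear_combination hdε u v w

end Geometry

end ContactCY
end

theorem mainTheorem4 {G : Type*} [Group G] [TopologicalSpace G] [IsTopologicalGroup G]
    [T2Space G] [LocallyCompactSpace G] [ConnectedSpace G]
    [ChartedSpace (EuclideanSpace ℝ (Fin 5)) G] [LieGroup (𝓡 5) ∞ G]
    (hnil : LieRing.IsNilpotent (GroupLieAlgebra (𝓡 5) G))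
    (Γ : Subgroup G) [DiscreteTopology Γ] [CompactSpace (ContactCY.LeftQuotient Γ)]
    (hM : ∃ S : ContactCY.ContactCalabiYau5 (EuclideanSpace ℝ (Fin 5)) (ContactCY.LeftQuotient Γ),
      S.IsInvariant) :
    ContactCY.IsType00001234 (GroupLieAlgebra (𝓡 5) G) := by
  obtain ⟨S, hS⟩ := hM
  obtain ⟨T⟩ := hS.nonempty_lieContactCY
  exact T.isType00001234 (finrank_euclideanSpace_fin (𝕜 := ℝ) (n := 5))
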